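/- Let $P$ be a probability distribution of pairs (feature vector, label) on $\mathcal{X}\times\mathcal{Y}$ and let $s:\mathcal{X}\times\mathcal{Y}\to\mathbb{R}$ be a measurable conformal score. Let $m\ge 1$, let $\mathcal{D}_{\mathrm{cal}}=((X_i,Y_i))_{i=1}^m$ be a calibration set of independent samples from $P$, and let $(X,Y)\sim P$ be a new sample independent of $\mathcal{D}_{\mathrm{cal}}$. For $\alpha\in[0,1]$ let $\hat q_\alpha$ be the $\frac{\lceil (m+1)(1-\alpha)\rceil}{m}$ empirical quantile of the calibration scores $s(X_1,Y_1),\dots,s(X_m,Y_m)$; here the empirical quantile of level $p$ is $$\inf\Big\{t\in[-\infty,\infty] : \tfrac1m\,\#\{i : s(X_i,Y_i)\le t\}\ge p\Big\},\qquad \inf\emptyset=+\infty,$$ so that $\hat q_\alpha$ is the $k$-th smallest calibration score, $k=\lceil (m+1)(1-\alpha)\rceil$, if $1\le k\le m$, while $\hat q_\alpha=-\infty$ if $k=0$ and $\hat q_\alpha=+\infty$ if $k=m+1$. For $0\le\alpha_1<\alpha_2\le 1$ let $$\mathcal{C}_{\alpha_1,\alpha_2}(x)=\{y\in\mathcal{Y}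 : \hat q_{\alpha_2}<s(x,y)\le \hat q_{\alpha_1}\}.$$ Assume that the calibration scores $s(X_1,Y_1),\dots,s(X_m,Y_m)$ are almost surely pairwise distinct (for $m=1$, where this says nothing, assume instead that the distribution of $s(X,Y)$ has no atoms). Then the random variable $\mathbb{P}[Y\in\mathcal{C}_{\alpha_1,\alpha_2}(X)\mid\mathcal{D}_{\mathrm{cal}}]$ satisfies $$\mathbb{P}[Y\in\mathcal{C}_{\alpha_1,\alpha_2}(X)\mid\mathcal{D}_{\mathrm{cal}}]\sim\mathrm{Beta}(l,\,m-l+1),\qquad l=\lceil(m+1)(1-\alpha_1)\rceil-\lceil(m+1)(1-\alpha_2)\rceil,$$ where, in the degenerate cases $l=0$ and $l=m+1$, $\mathrm{Beta}(0,m+1)$ denotes the unit mass at $0$ and $\mathrm{Beta}(m+1,0)$ the unit mass at $1$. -/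

import Mathlib

open MeasureTheory ProbabilityTheory

noncomputable section

/-- The empirical quantile of level `p` of the numbers `v 0, …, v (m - 1)`: the generalized inverse
`inf {t : p ≤ F t}` of their empirical distribution function `F t = #{i | v i ≤ t} / m`, the infimum
being taken in the extended reals. For `1 ≤ k ≤ m` the quantile of level `k / m` is the `k`-th
smallest of the numbers, the quantile of level `0` is `-∞`, and a level above `1` gives `+∞`. -/
def empiricalQuantile {m : ℕ} (v : Fin m → ℝ) (p : ℝ) : EReal :=
  sInf {t : EReal | p ≤ (Nat.card {i : Fin m // (v i : EReal) ≤ t} : ℝ) / (m : ℝ)}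

/-- The threshold `q̂_α`: the empirical quantile of level `⌈(m + 1) (1 - α)⌉ / m` of the `m`
calibration scores `v`. -/
def conformalThreshold {m : ℕ} (v : Fin m → ℝ) (α : ℝ) : EReal :=
  empiricalQuantile v ((⌈((m : ℝ) + 1) * (1 - α)⌉ : ℝ) / (m : ℝ))

/-- The two-threshold prediction set `{y | q̂_{α₂} < s(x, y) ≤ q̂_{α₁}}` built from the conformal
score `s` and the calibration scores `v`. -/
def twoThresholdSet {𝒳 𝒴 : Type*} {m : ℕ} (s : 𝒳 → 𝒴 → ℝ) (v : Fin m → ℝ) (α₁ α₂ : ℝ)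
    (x : 𝒳) : Set 𝒴 :=
  {y | conformalThreshold v α₂ < (s x y : EReal) ∧ (s x y : EReal) ≤ conformalThreshold v α₁}

/-- The law `Beta(a, b)` on the real line, with the usual (limiting) convention for a vanishing
parameter: `Beta(0, b)` is the unit mass at `0` and `Beta(a, 0)` is the unit mass at `1`. -/
def betaLaw (a b : ℝ) : Measure ℝ :=
  if a = 0 then Measure.dirac 0 else if b = 0 then Measure.dirac 1 else betaMeasure a b

end

/-!
When the score law has no atoms, its distribution function turns the calibration scores into
independent uniform variables `U_i`, and the conditional probability that a new score falls between
the `a`-th and the `b`-th calibration score is `U_(b) - U_(a)`, with `U_(0) = 0` and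
`U_(m+1) = 1`. Place the points on a circle and rotate it so that the smallest one becomes the
origin, which then takes the place of that point: this preserves volume and shifts the spacings
cyclically, so the law of `U_(b) - U_(a)` only depends on `l = b - a` and is that of `U_(l)`.
Finally `U_(l) ≤ t` says that at least `l` of the `m` points lie below `t`, an event of binomial
probability, and the binomial tail is an antiderivative of the `Beta(l, m - l + 1)` density because
the derivatives of the Bernstein polynomials telescope.
-/

open scoped Finset unitInterval

section OrderStatistic

variable {ι α : Type*} [Fintype ι] [CompleteLinearOrder α]

/-- The `k`-th smallest value of the finite family `v`, counted from `k = 1`. As an infimum in a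
complete linear order it is `⊥` at `k = 0` and `⊤` once `k` exceeds the size of the family, which
are the conventions in force for quantiles in the extended reals and for spacings in `[0, 1]`. -/
def orderStatistic (v : ι → α) (k : ℕ) : α :=
  sInf {t | k ≤ #{i | v i ≤ t}}

lemma orderStatistic_zero (v : ι → α) : orderStatistic v 0 = ⊥ := by
  simp [orderStatistic, Set.ofPred_true]

lemma orderStatistic_of_card_lt (v : ι → α) {k : ℕ} (hk : Fintype.card ι < k) :
    orderStatistic v k = ⊤ := by
  have hempty : {t | k ≤ #{i | v i ≤ t}} = ∅ :=
    Set.eq_empty_of_forall_notMem fun t ht => (ht.trans (Finset.card_le_univ _)).not_gt hk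
  rw [orderStatistic, hempty, sInf_empty]

lemma orderStatistic_mono (v : ι → α) : Monotone (orderStatistic v) :=
  fun _ _ h => sInf_le_sInf fun _ ht => h.trans ht

lemma orderStatistic_le_iff_of_lt_top (v : ι → α) (k : ℕ) {t : α} (ht : t < ⊤) :
    orderStatistic v k ≤ t ↔ k ≤ #{i | v i ≤ t} := by
  refine ⟨fun h => ?_, fun h => sInf_le h⟩
  by_contra! hlt
  let c : α := Finset.inf {i | t < v i} v
  have htc : t < c := (Finset.lt_inf_iff ht).2 fun i hi => (Finset.mem_filter.1 hi).2
  refine (h.trans_lt htc).not_ge (le_sInf fun t' ht' => ?_)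
  by_contra! hc
  refine (ht'.trans (Finset.card_le_card fun i hi => ?_)).not_gt hlt
  simp only [Finset.mem_filter, Finset.mem_univ, true_and] at hi ⊢
  by_contra! hi'
  exact (hi.trans_lt hc).not_ge (Finset.inf_le (by simpa using hi'))

lemma orderStatistic_le_iff (v : ι → α) {k : ℕ} (hk : k ≤ Fintype.card ι) (t : α) :
    orderStatistic v k ≤ t ↔ k ≤ #{i | v i ≤ t} := by
  rcases eq_top_or_lt_top t with rfl | ht
  · simpa using hk
  · exact orderStatistic_le_iff_of_lt_top v k ht

lemma map_orderStatistic {β : Type*} [CompleteLinearOrder β] {f : α → β} (hf : Monotone f)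
    (hbot : f ⊥ = ⊥) (htop : f ⊤ = ⊤) (v : ι → α) (k : ℕ) :
    f (orderStatistic v k) = orderStatistic (f ∘ v) k := by
  apply le_antisymm
  · refine le_sInf fun y hy => ?_
    let S : Finset ι := {i | f (v i) ≤ y}
    calc f (orderStatistic v k) ≤ f (S.sup v) := hf <| sInf_le <| hy.trans <|
          Finset.card_le_card fun i hi => by simpa using Finset.le_sup (f := v) hi
      _ = S.sup (f ∘ v) := Finset.apply_sup_eq_sup_comp_of_linearOrder f hf hbot
      _ ≤ y := Finset.sup_le fun i hi => (Finset.mem_filter.1 hi).2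
  · rcases eq_top_or_lt_top (orderStatistic v k) with h | h
    · simp [h, htop]
    · refine sInf_le (((orderStatistic_le_iff_of_lt_top v k h).1 le_rfl).trans ?_)
      exact Finset.card_le_card fun i hi => by
        simpa using hf (by simpa using hi : v i ≤ orderStatistic v k)

variable [TopologicalSpace α] [OrderTopology α] [SecondCountableTopology α] [MeasurableSpace α]
  [BorelSpace α]

lemma measurable_card_filter_le (t : α) : Measurable fun v : ι → α => #{i | v i ≤ t} := by
  simp only [Finset.card_filter]
  exact Finset.measurable_fun_sum _ fun i _ => Measurable.ite
    (measurableSet_le (measurable_pi_apply i) measurable_const) measurable_const measurable_const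

lemma measurable_orderStatistic (k : ℕ) : Measurable fun v : ι → α => orderStatistic v k := by
  refine measurable_of_Iic fun t => ?_
  rcases eq_top_or_lt_top t with rfl | ht
  · simp
  · have hpre : (fun v : ι → α => orderStatistic v k) ⁻¹' Set.Iic t =
        {v | k ≤ #{i | v i ≤ t}} :=
      Set.ext fun v => orderStatistic_le_iff_of_lt_top v k ht
    rw [hpre]
    exact measurableSet_le measurable_const (measurable_card_filter_le t)

end OrderStatistic

lemma conformalThreshold_eq_orderStatistic {m : ℕ} (hm : 0 < m) (v : Fin m → ℝ) (α : ℝ) :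
    conformalThreshold v α =
      orderStatistic (fun i => (v i : EReal)) ⌈((m : ℝ) + 1) * (1 - α)⌉₊ := by
  have hm' : (0 : ℝ) < m := mod_cast hm
  have hlevel : ∀ t : EReal,
      (⌈((m : ℝ) + 1) * (1 - α)⌉ : ℝ) / m ≤ (Nat.card {i // (v i : EReal) ≤ t} : ℝ) / m ↔
        ⌈((m : ℝ) + 1) * (1 - α)⌉₊ ≤ #{i | (v i : EReal) ≤ t} := fun t => by
    rw [div_le_div_iff_of_pos_right hm', Nat.card_eq_fintype_card, Fintype.card_subtype,
      ← Int.cast_natCast #_, Int.cast_le, Int.ceil_le, Int.cast_natCast, Nat.ceil_le]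
  simp only [conformalThreshold, empiricalQuantile, orderStatistic, hlevel]

lemma measurableEmbedding_pi_coe_unitInterval {ι : Type*} [Finite ι] :
    MeasurableEmbedding fun (u : ι → I) i => (u i : ℝ) :=
  (Continuous.isClosedEmbedding (by fun_prop) fun _ _ h =>
    funext fun i => Subtype.ext (congrFun h i)).measurableEmbedding

lemma volume_image_coe_unitInterval {ι : Type*} [Fintype ι] (S : Set (ι → I)) :
    volume ((fun (u : ι → I) i => (u i : ℝ)) '' S) = volume S := by
  have hcoe : MeasurePreserving (fun (u : ι → I) i => (u i : ℝ)) volume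
      (volume.restrict (Set.univ.pi fun _ => I)) := by
    rw [volume_pi, volume_pi, Measure.restrict_pi_pi]
    exact measurePreserving_pi _ _ fun _ => unitInterval.measurePreserving_coe
  have hemb := measurableEmbedding_pi_coe_unitInterval (ι := ι)
  have hcube : (fun (u : ι → I) i => (u i : ℝ)) '' S ⊆ Set.univ.pi fun _ => I := by
    rintro _ ⟨u, -, rfl⟩ i -
    exact (u i).2
  rw [← Measure.restrict_eq_self _ hcube, ← hcoe.measure_preimage_emb hemb,
    Set.preimage_image_eq _ hemb.injective]

noncomputable section RotateSpacings

variable {ι : Type*} [DecidableEq ι]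

/-- The affine map with `x j ↦ 1 - x j` and `x i ↦ x i - x j` for `i ≠ j`. If `x j` is the smallest
of the points `x i ∈ [0, 1]`, it replaces `x j` by the endpoint `1` and then moves the origin to
`x j`, so that the first spacing becomes the last one. -/
def rotateSpacings (j : ι) (x : ι → ℝ) : ι → ℝ :=
  fun i => if i = j then 1 - x j else x i - x j

/-- The map `rotateSpacings j` on the unit cube, clamped where it would leave the cube. -/
def rotateUnitSpacings (j : ι) (u : ι → I) : ι → I :=
  fun i => Set.projIcc 0 1 zero_le_one (rotateSpacings j (fun i => (u i : ℝ)) i)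

lemma coe_rotateUnitSpacings {j : ι} {u : ι → I} (hu : ∀ i, u j ≤ u i) (i : ι) :
    (rotateUnitSpacings j u i : ℝ) = rotateSpacings j (fun i => (u i : ℝ)) i := by
  have hmem : rotateSpacings j (fun i => (u i : ℝ)) i ∈ I := by
    have hle : (u j : ℝ) ≤ u i := hu i
    have hi := (u i).2
    have hj := (u j).2
    simp only [rotateSpacings, Set.mem_Icc] at *
    split_ifs <;> constructor <;> linarith
  rw [rotateUnitSpacings, Set.projIcc_of_mem _ hmem]

lemma measurable_rotateUnitSpacings (j : ι) : Measurable (rotateUnitSpacings j) := by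
  refine measurable_pi_lambda _ fun i => continuous_projIcc.measurable.comp ?_
  by_cases hi : i = j <;> simp only [rotateSpacings, hi, if_true, if_false] <;> fun_prop

lemma rotateUnitSpacings_le_iff {j : ι} {u : ι → I} (hu : ∀ i, u j ≤ u i) {x y : I}
    (hxy : (y : ℝ) = x + u j) (i : ι) :
    rotateUnitSpacings j u i ≤ x ↔ if i = j then y = 1 else u i ≤ y := by
  rw [← Subtype.coe_le_coe, coe_rotateUnitSpacings hu]
  split_ifs with hi
  · rw [← Set.Icc.coe_eq_one]
    have := y.2.2
    simp only [rotateSpacings, hi, if_true]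
    constructor <;> intro <;> linarith
  · simp only [rotateSpacings, hi, if_false, ← Subtype.coe_le_coe, hxy, sub_le_iff_le_add]

lemma image_coe_preimage_rotateUnitSpacings (j : ι) (S : Set (ι → I)) :
    (fun (u : ι → I) i => (u i : ℝ)) '' (rotateUnitSpacings j ⁻¹' S ∩ {u | ∀ i, u j ≤ u i}) =
      rotateSpacings j ⁻¹'
        ((fun (u : ι → I) i => (u i : ℝ)) '' (S ∩ {u | ∀ i, u i ≤ u j})) := by
  ext x
  constructor
  · rintro ⟨u, ⟨huS, hu⟩, rfl⟩
    refine ⟨rotateUnitSpacings j u, ⟨huS, fun i => ?_⟩, funext (coe_rotateUnitSpacings hu)⟩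
    rw [← Subtype.coe_le_coe, coe_rotateUnitSpacings hu, coe_rotateUnitSpacings hu]
    by_cases hi : i = j
    · rw [hi]
    · simpa [rotateSpacings, hi] using (u i).2.2
  · rintro ⟨w, ⟨hwS, hw⟩, hwx⟩
    have hj : (w j : ℝ) = 1 - x j := by simpa [rotateSpacings] using congrFun hwx j
    have hi : ∀ i ≠ j, (w i : ℝ) = x i - x j := fun i hi => by
      simpa [rotateSpacings, hi] using congrFun hwx i
    have hmem : ∀ i, x j ≤ x i ∧ x i ∈ I := fun i => by
      have hle : (w i : ℝ) ≤ w j := hw i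
      have hwi := (w i).2
      have hwj := (w j).2
      rcases eq_or_ne i j with rfl | hij
      · exact ⟨le_rfl, by linarith [hwj.2], by linarith [hwj.1]⟩
      · have := hi i hij
        exact ⟨by linarith [hwi.1], by linarith [hwi.1, hwj.2], by linarith⟩
    have hu : ∀ i, (⟨x j, (hmem j).2⟩ : I) ≤ ⟨x i, (hmem i).2⟩ := fun i => (hmem i).1
    refine ⟨fun i => ⟨x i, (hmem i).2⟩, ⟨?_, hu⟩, rfl⟩
    have hrot : rotateUnitSpacings j (fun i => ⟨x i, (hmem i).2⟩) = w := funext fun i =>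
      Subtype.ext <| (coe_rotateUnitSpacings hu i).trans (congrFun hwx i).symm
    rwa [Set.mem_preimage, hrot]

variable [Fintype ι]

lemma measurePreserving_rotateSpacings (j : ι) :
    MeasurePreserving (rotateSpacings j) (volume : Measure (ι → ℝ)) volume := by
  let T : (ι → ℝ) →ₗ[ℝ] (ι → ℝ) :=
    { toFun := fun x i => if i = j then -x j else x i - x j
      map_add' := fun x y => by
        ext i; simp only [Pi.add_apply]; split_ifs <;> ring
      map_smul' := fun c x => by
        ext i; simp only [Pi.smul_apply, smul_eq_mul, RingHom.id_apply]; split_ifs <;> ring }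
  have hinvol : T ∘ₗ T = LinearMap.id := by
    refine LinearMap.ext fun x => funext fun i => ?_
    by_cases h : i = j <;> simp [T, h]
  have hdet : LinearMap.det T * LinearMap.det T = 1 := by
    rw [← LinearMap.det_comp, hinvol, LinearMap.det_id]
  have hdet_ne : LinearMap.det T ≠ 0 := fun h => by simp [h] at hdet
  have hdet_abs : |(LinearMap.det T)⁻¹| = 1 := by
    rcases mul_self_eq_one_iff.1 hdet with h | h <;> simp [h]
  have hT : MeasurePreserving T (volume : Measure (ι → ℝ)) volume := by
    refine ⟨T.continuous_of_finiteDimensional.measurable, ?_⟩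
    rw [Real.map_linearMap_volume_pi_eq_smul_volume_pi hdet_ne, hdet_abs]
    simp
  have htranslate : rotateSpacings j = (Pi.single j 1 + ·) ∘ T := by
    ext x i
    by_cases hi : i = j
    · subst hi; simp [rotateSpacings, T, sub_eq_add_neg]
    · simp [rotateSpacings, T, hi]
  rw [htranslate]
  exact (measurePreserving_add_left volume _).comp hT

lemma measurePreserving_rotateUnitSpacings (j : ι) :
    MeasurePreserving (rotateUnitSpacings j)
      (volume.restrict {u | ∀ i, u j ≤ u i}) (volume.restrict {u | ∀ i, u i ≤ u j}) := by
  have hrot := measurable_rotateUnitSpacings j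
  refine ⟨hrot, Measure.ext fun S hS => ?_⟩
  have hmax : MeasurableSet {u : ι → I | ∀ i, u i ≤ u j} := by measurability
  have himage := (measurableEmbedding_pi_coe_unitInterval (ι := ι)).measurableSet_image.2
    (hS.inter hmax)
  rw [Measure.map_apply hrot hS, Measure.restrict_apply hS, Measure.restrict_apply (hrot hS),
    ← volume_image_coe_unitInterval, image_coe_preimage_rotateUnitSpacings,
    (measurePreserving_rotateSpacings j).measure_preimage himage.nullMeasurableSet,
    volume_image_coe_unitInterval]

end RotateSpacings

section UniformSpacings

variable {ι : Type*} [Fintype ι]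

/-- The distance from the `a`-th to the `b`-th smallest of the points `u i ∈ [0, 1]`, where the
point of index `0` is `0` and the point of any index beyond the number of points is `1`. -/
noncomputable def spacing (u : ι → I) (a b : ℕ) : ℝ :=
  (orderStatistic u b : I) - (orderStatistic u a : I)

lemma measurable_spacing (a b : ℕ) : Measurable fun u : ι → I => spacing u a b :=
  (measurable_orderStatistic b).subtype_val.sub (measurable_orderStatistic a).subtype_val

lemma orderStatistic_rotateUnitSpacings_le_iff [DecidableEq ι] {j : ι} {u : ι → I}
    (hu : ∀ i, u j ≤ u i) {k : ℕ} (hk : k ≤ Fintype.card ι) {x y : I} (hxy : (y : ℝ) = x + u j) :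
    orderStatistic (rotateUnitSpacings j u) k ≤ x ↔ orderStatistic u (k + 1) ≤ y := by
  rw [orderStatistic_le_iff _ hk]
  rcases eq_top_or_lt_top y with rfl | hy
  · have hall : ∀ i, rotateUnitSpacings j u i ≤ x := fun i =>
      (rotateUnitSpacings_le_iff hu hxy i).2 (by split_ifs; exacts [rfl, le_top])
    simpa [hall] using hk
  · have hinsert : Finset.univ.filter (u · ≤ y) =
        insert j (Finset.univ.filter (rotateUnitSpacings j u · ≤ x)) := by
      have hjy : u j ≤ y := by
        rw [← Subtype.coe_le_coe, hxy]
        exact le_add_of_nonneg_left x.2.1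
      ext i
      by_cases hi : i = j <;> simp [rotateUnitSpacings_le_iff hu hxy, hi, hjy]
    rw [orderStatistic_le_iff_of_lt_top _ _ hy, hinsert, Finset.card_insert_of_notMem,
      Nat.add_le_add_iff_right]
    simpa [rotateUnitSpacings_le_iff hu hxy] using show y ≠ 1 from hy.ne

lemma coe_orderStatistic_rotateUnitSpacings [DecidableEq ι] {j : ι} {u : ι → I}
    (hu : ∀ i, u j ≤ u i) {k : ℕ} (hk : k ≤ Fintype.card ι) :
    ((orderStatistic (rotateUnitSpacings j u) k : I) : ℝ) =
      (orderStatistic u (k + 1) : I) - u j := by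
  have hmin : u j ≤ orderStatistic u (k + 1) := le_sInf fun t ht => by
    obtain ⟨i, hi⟩ := Finset.card_pos.1 (k.succ_pos.trans_le ht)
    exact (hu i).trans (Finset.mem_filter.1 hi).2
  have hmax : ((orderStatistic (rotateUnitSpacings j u) k : I) : ℝ) ≤ 1 - u j :=
    (orderStatistic_rotateUnitSpacings_le_iff hu hk (x := σ (u j)) (y := 1) (by simp)).2 le_top
  apply le_antisymm
  · have hmem : ((orderStatistic u (k + 1) : I) - u j : ℝ) ∈ I :=
      ⟨sub_nonneg.2 hmin, (sub_le_self _ (u j).2.1).trans (orderStatistic u (k + 1)).2.2⟩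
    exact (orderStatistic_rotateUnitSpacings_le_iff hu hk (x := ⟨_, hmem⟩)
      (sub_add_cancel _ _).symm).2 le_rfl
  · have hmem : ((orderStatistic (rotateUnitSpacings j u) k : I) + u j : ℝ) ∈ I :=
      ⟨add_nonneg (orderStatistic (rotateUnitSpacings j u) k).2.1 (u j).2.1, by linarith⟩
    exact sub_le_iff_le_add.2 <|
      (orderStatistic_rotateUnitSpacings_le_iff hu hk (y := ⟨_, hmem⟩) rfl).1 le_rfl

lemma ae_injective_pi {α : Type*} [MeasurableSpace α] [MeasurableEq α] (ν : Measure α)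
    [IsProbabilityMeasure ν] [NullSingletonClass ν] :
    ∀ᵐ u ∂Measure.pi fun _ : ι => ν, Function.Injective u := by
  have hne : ∀ i j : ι, i ≠ j → ∀ᵐ u ∂Measure.pi fun _ : ι => ν, u i ≠ u j := fun i j hij => by
    have hindep : IndepFun (fun u : ι → α => u i) (fun u => u j) (Measure.pi fun _ => ν) :=
      (iIndepFun_pi (X := fun (_ : ι) (x : α) => x) fun _ => aemeasurable_id).indepFun hij
    have hlaw : (Measure.pi fun _ : ι => ν).map (fun u => (u i, u j)) = ν.prod ν := by
      rw [(indepFun_iff_map_prod_eq_prod_map_map (measurable_pi_apply i).aemeasurable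
          (measurable_pi_apply j).aemeasurable).1 hindep,
        (measurePreserving_eval _ i).map_eq, (measurePreserving_eval _ j).map_eq]
    have hdiag : ν.prod ν (Set.diagonal α) = 0 := by
      refine (Measure.measure_prod_null measurableSet_diagonal).2 (ae_of_all _ fun x => ?_)
      simp [Set.preimage, Set.diagonal]
    rw [← hlaw, Measure.map_apply (by fun_prop) measurableSet_diagonal] at hdiag
    exact measure_eq_zero_iff_ae_notMem.1 hdiag
  simp only [← Filter.eventually_imp_distrib_left, ← ae_all_iff] at hne
  filter_upwards [hne] with u hu i j h
  by_contra hij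
  exact hu i j hij h

lemma measure_eq_sum_inter_extremal {α : Type*} [MeasurableSpace α] {μ : Measure (ι → α)}
    (hinj : ∀ᵐ u ∂μ, Function.Injective u) {r : α → α → Prop} [Std.Antisymm r]
    (hr : MeasurableSet {p : α × α | r p.1 p.2}) (hex : ∀ u : ι → α, ∃ j, ∀ i, r (u j) (u i))
    {E : Set (ι → α)} (hE : MeasurableSet E) :
    μ E = ∑ j, μ (E ∩ {u | ∀ i, r (u j) (u i)}) := by
  have hcover : E = ⋃ j, E ∩ {u | ∀ i, r (u j) (u i)} :=
    Set.ext fun u => by simp [hex u]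
  have hmeas : ∀ j, MeasurableSet {u : ι → α | ∀ i, r (u j) (u i)} := fun j => by
    rw [Set.ofPred_forall]
    exact .iInter fun i => measurableSet_preimage
      (f := fun u : ι → α => (u j, u i)) (by fun_prop) hr
  have hdisj : Pairwise (Function.onFun (AEDisjoint μ) fun j => E ∩ {u | ∀ i, r (u j) (u i)}) :=
    fun j k hjk => measure_mono_null (t := {u | ¬ Function.Injective u})
      (fun u ⟨⟨_, hj⟩, ⟨_, hk⟩⟩ hu => hjk (hu (antisymm_of r (hj k) (hk j)))) (ae_iff.1 hinj)
  conv_lhs => rw [hcover]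
  rw [measure_iUnion₀ hdisj fun j => (hE.inter (hmeas j)).nullMeasurableSet, tsum_fintype]

lemma spacing_rotateUnitSpacings [DecidableEq ι] {j : ι} {u : ι → I} (hu : ∀ i, u j ≤ u i)
    {a b : ℕ} (ha : a ≤ Fintype.card ι) (hb : b ≤ Fintype.card ι) :
    spacing (rotateUnitSpacings j u) a b = spacing u (a + 1) (b + 1) := by
  rw [spacing, coe_orderStatistic_rotateUnitSpacings hu ha,
    coe_orderStatistic_rotateUnitSpacings hu hb, sub_sub_sub_cancel_right, spacing]

variable [Nonempty ι] {a b l : ℕ}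

lemma map_spacing_succ_succ (ha : a ≤ Fintype.card ι) (hb : b ≤ Fintype.card ι) :
    (volume : Measure (ι → I)).map (spacing · (a + 1) (b + 1)) =
      (volume : Measure (ι → I)).map (spacing · a b) := by
  classical
  ext S hS
  have hinj : ∀ᵐ u : ι → I, Function.Injective u := ae_injective_pi volume
  have hS' : ∀ a b, MeasurableSet ((spacing · a b : (ι → I) → ℝ) ⁻¹' S) := fun a b =>
    measurable_spacing a b hS
  calc volume.map (spacing · (a + 1) (b + 1)) S
      = ∑ j, volume ((spacing · (a + 1) (b + 1)) ⁻¹' S ∩ {u : ι → I | ∀ i, u j ≤ u i}) := by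
        rw [Measure.map_apply (measurable_spacing _ _) hS,
          measure_eq_sum_inter_extremal hinj measurableSet_le' Finite.exists_min (hS' _ _)]
    _ = ∑ j, volume ((spacing · a b) ⁻¹' S ∩ {u : ι → I | ∀ i, u i ≤ u j}) := by
        refine Finset.sum_congr rfl fun j _ => ?_
        have hrot := (measurePreserving_rotateUnitSpacings j).measure_preimage
          (hS' a b).nullMeasurableSet
        rw [Measure.restrict_apply (hS' a b), Measure.restrict_apply
          (measurable_rotateUnitSpacings j (hS' a b))] at hrot
        rw [← hrot]
        congr 1
        ext u
        refine and_congr_left fun hu => ?_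
        simp only [Set.mem_preimage, spacing_rotateUnitSpacings hu ha hb]
    _ = volume.map (spacing · a b) S := by
        rw [Measure.map_apply (measurable_spacing _ _) hS,
          measure_eq_sum_inter_extremal (r := (· ≥ ·)) hinj
            (measurableSet_le measurable_snd measurable_fst) Finite.exists_max (hS' _ _)]

lemma map_spacing_add (h : a + l ≤ Fintype.card ι + 1) :
    (volume : Measure (ι → I)).map (spacing · a (a + l)) =
      (volume : Measure (ι → I)).map (spacing · 0 l) := by
  induction a with
  | zero => simp only [zero_add]
  | succ a ih =>
    rw [← ih (by lia), ← map_spacing_succ_succ (a := a) (b := a + l) (by lia) (by lia),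
      add_right_comm]

end UniformSpacings

section OrderStatisticLaw

variable {ι : Type*} [Fintype ι]

section Bernoulli

variable {α : Type*} [MeasurableSpace α] (ν : Measure α) [IsProbabilityMeasure ν] {P : α → Prop}
  {p : I}

lemma map_prop_eq_bernoulli (hP : Measurable P) (hp : ν.real {x | P x} = p) :
    ν.map P =
      unitInterval.toNNReal p • Measure.dirac True +
        unitInterval.toNNReal (σ p) • Measure.dirac False := by
  have := Measure.isProbabilityMeasure_map (μ := ν) hP.aemeasurable
  refine Measure.ext_of_measureReal_singleton fun q => ?_
  rw [map_measureReal_apply hP (measurableSet_singleton q)]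
  by_cases hq : q
  · have hpre : P ⁻¹' {q} = {x | P x} := by ext; simp [hq]
    rw [hpre, hp]
    simp [hq, measureReal_def]
  · have hpre : P ⁻¹' {q} = {x | P x}ᶜ := by ext; simp [hq]
    rw [hpre, probReal_compl_eq_one_sub hP.setOf, hp]
    simp [hq, measureReal_def]

lemma map_setOf_pi_eq_setBernoulli (hP : Measurable P) (hp : ν.real {x | P x} = p) :
    (Measure.pi fun _ : ι => ν).map (fun u => {i | P (u i)}) = setBer(Set.univ, p) := by
  rw [setBernoulli_eq_map, Measure.infinitePi_eq_pi]
  simp only [Set.mem_univ, ← map_prop_eq_bernoulli ν hP hp]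
  have := Measure.isProbabilityMeasure_map (μ := ν) hP.aemeasurable
  rw [← Measure.pi_map_pi fun _ => hP.aemeasurable, Measure.map_map (by fun_prop) (by fun_prop)]
  rfl

lemma map_card_filter_pi_eq_binomial [DecidablePred P] (hP : Measurable P)
    (hp : ν.real {x | P x} = p) :
    (Measure.pi fun _ : ι => ν).map (fun u => #{i | P (u i)}) = Bin(Fintype.card ι, p) := by
  have hncard : (fun u : ι → α => #{i | P (u i)}) = Set.ncard ∘ fun u => {i | P (u i)} := by
    ext u
    simp [Set.ncard_eq_toFinset_card']
  rw [hncard, ← Measure.map_map (by fun_prop) (by fun_prop), map_setOf_pi_eq_setBernoulli ν hP hp]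
  refine Measure.ext_of_measureReal_singleton fun k => ?_
  rw [map_ncard_setBernoulli_real_singleton Set.finite_univ, binomial_real_singleton,
    Set.ncard_univ, Nat.card_eq_fintype_card]

end Bernoulli

lemma binomial_real_Ici (n l : ℕ) (p : I) :
    Bin(n, p).real (Set.Ici l) =
      ∑ k ∈ Finset.Ico l (n + 1), (bernsteinPolynomial ℝ n k).eval (p : ℝ) := by
  have hIco : {k ∈ Finset.Iic n | l ≤ k} = Finset.Ico l (n + 1) := by
    ext k
    simp [and_comm]
  rw [← integral_indicator_one measurableSet_Ici, integral_binomial, ← hIco, Finset.sum_filter]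
  simp [Set.indicator_apply, bernsteinPolynomial]

open Finset Polynomial in
lemma derivative_sum_bernsteinPolynomial {n l : ℕ} (h : l ≤ n) :
    derivative (∑ k ∈ Ico (l + 1) (n + 2), bernsteinPolynomial ℝ (n + 1) k) =
      (n + 1 : ℝ[X]) * bernsteinPolynomial ℝ n l := by
  rw [← sum_Ico_add', derivative_sum]
  simp only [bernsteinPolynomial.derivative_succ_aux, ← mul_sum]
  congr 1
  rw [← neg_inj, ← sum_neg_distrib]
  simp only [neg_sub]
  rw [sum_Ico_sub _ (by lia), bernsteinPolynomial.eq_zero_of_lt ℝ (by lia), zero_sub]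

lemma betaPDF_succ_succ (a b : ℕ) {x : ℝ} (hx : x ∈ Set.Ioo (0 : ℝ) 1) :
    betaPDF (a + 1) (b + 1) x =
      ENNReal.ofReal (((a + b : ℕ) + 1) * (bernsteinPolynomial ℝ (a + b) a).eval x) := by
  have hsum : (a : ℝ) + 1 + (b + 1) = ((a + b + 1 : ℕ) : ℝ) + 1 := by push_cast; ring
  have hchoose : ((a + b).choose a : ℝ) * a.factorial * b.factorial = (a + b).factorial := by
    rw [Nat.choose_symm_add]
    exact_mod_cast Nat.add_choose_mul_factorial_mul_factorial a b
  rw [betaPDF_of_pos_lt_one hx.1 hx.2, beta, hsum]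
  simp only [Real.Gamma_nat_eq_factorial, add_sub_cancel_right, Real.rpow_natCast,
    Nat.factorial_succ, bernsteinPolynomial, Polynomial.eval_mul, Polynomial.eval_natCast,
    Polynomial.eval_pow, Polynomial.eval_X, Polynomial.eval_sub, Polynomial.eval_one,
    Nat.add_sub_cancel_left, Nat.cast_mul, ← hchoose]
  push_cast
  field_simp

lemma betaMeasure_compl_unitInterval (a b : ℝ) : betaMeasure a b Iᶜ = 0 := by
  rw [betaMeasure, withDensity_apply _ measurableSet_Icc.compl]
  refine setLIntegral_eq_zero measurableSet_Icc.compl fun x hx => ?_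
  rw [betaPDF_eq, if_neg fun h => hx ⟨h.1.le, h.2.le⟩, ENNReal.ofReal_zero, Pi.zero_apply]

lemma betaMeasure_Icc_eq_binomial_Ici (a b : ℕ) (x : I) :
    betaMeasure (a + 1) (b + 1) (Set.Icc 0 x) = Bin(a + b + 1, x) (Set.Ici (a + 1)) := by
  let B := bernsteinPolynomial ℝ (a + b) a
  let tail := ∑ k ∈ Finset.Ico (a + 1) (a + b + 2), bernsteinPolynomial ℝ (a + b + 1) k
  have hderiv : ∀ t : ℝ, HasDerivAt (fun t => tail.eval t) (((a + b : ℕ) + 1) * B.eval t) t :=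
    fun t => by
      simpa [tail, B, derivative_sum_bernsteinPolynomial (Nat.le_add_right a b)]
        using tail.hasDerivAt t
  have hzero : tail.eval 0 = 0 := by
    rw [Polynomial.eval_finsetSum]
    refine Finset.sum_eq_zero fun k hk => ?_
    rw [bernsteinPolynomial.eval_at_0, if_neg (by have := Finset.mem_Ico.1 hk; lia)]
  have hcont : Continuous fun t : ℝ => ((a + b : ℕ) + 1 : ℝ) * B.eval t :=
    continuous_const.mul B.continuous
  have hnonneg : ∀ t ∈ Set.Ioc 0 (x : ℝ), 0 ≤ ((a + b : ℕ) + 1 : ℝ) * B.eval t := fun t ht => by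
    have hB := bernstein_nonneg (n := a + b) (ν := a) (x := ⟨t, ht.1.le, ht.2.trans x.2.2⟩)
    exact mul_nonneg (by positivity) hB
  calc betaMeasure (a + 1) (b + 1) (Set.Icc 0 x)
      = ∫⁻ t in Set.Ioo 0 (x : ℝ), betaPDF (a + 1) (b + 1) t := by
        rw [betaMeasure, withDensity_apply _ measurableSet_Icc, setLIntegral_congr Ioo_ae_eq_Icc]
    _ = ∫⁻ t in Set.Ioo 0 (x : ℝ), ENNReal.ofReal (((a + b : ℕ) + 1) * B.eval t) :=
        setLIntegral_congr_fun measurableSet_Ioo fun t ht =>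
          betaPDF_succ_succ a b ⟨ht.1, ht.2.trans_le x.2.2⟩
    _ = ENNReal.ofReal (∫ t in (0 : ℝ)..x, ((a + b : ℕ) + 1) * B.eval t) := by
        rw [intervalIntegral.integral_of_le x.2.1, setLIntegral_congr Ioo_ae_eq_Ioc,
          ofReal_integral_eq_lintegral_ofReal hcont.integrableOn_Ioc
            (ae_restrict_of_forall_mem measurableSet_Ioc hnonneg)]
    _ = Bin(a + b + 1, x) (Set.Ici (a + 1)) := by
        rw [intervalIntegral.integral_eq_sub_of_hasDerivAt (fun t _ => hderiv t)
          (hcont.intervalIntegrable _ _), hzero, sub_zero, Polynomial.eval_finsetSum,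
          ← binomial_real_Ici, ofReal_measureReal]

lemma map_orderStatistic_succ_eq_betaMeasure {a b : ℕ} (hcard : Fintype.card ι = a + b + 1) :
    (volume : Measure (ι → I)).map (fun u => ((orderStatistic u (a + 1) : I) : ℝ)) =
      betaMeasure (a + 1) (b + 1) := by
  have hcoe := MeasurableEmbedding.subtype_coe (measurableSet_Icc (a := (0 : ℝ)) (b := 1))
  have hunit : (volume : Measure (ι → I)).map (orderStatistic · (a + 1)) =
      (betaMeasure (a + 1) (b + 1)).comap ((↑) : I → ℝ) := by
    refine Measure.ext_of_Iic _ _ fun x => ?_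
    have hcount : (volume : Measure (ι → I)).map (fun u => #{i | u i ≤ x}) =
        Bin(Fintype.card ι, x) :=
      map_card_filter_pi_eq_binomial volume (measurableSet_setOfPred.1 measurableSet_Iic)
        (show volume.real (Set.Iic x) = x by simp [measureReal_def, x.2.1])
    have himage : ((↑) : I → ℝ) '' Set.Iic x = Set.Icc 0 (x : ℝ) := by
      ext
      simp
    have hpre : (fun u : ι → I => orderStatistic u (a + 1)) ⁻¹' Set.Iic x =
        (fun u : ι → I => #{i | u i ≤ x}) ⁻¹' Set.Ici (a + 1) :=
      Set.ext fun u => orderStatistic_le_iff u (by lia) x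
    rw [Measure.map_apply (measurable_orderStatistic _) measurableSet_Iic, hpre,
      ← Measure.map_apply (measurable_card_filter_le x) measurableSet_Ici, hcount, hcard,
      hcoe.comap_apply, himage, betaMeasure_Icc_eq_binomial_Ici]
  change volume.map (((↑) : I → ℝ) ∘ (orderStatistic · (a + 1))) = _
  rw [← Measure.map_map hcoe.measurable (measurable_orderStatistic _), hunit, hcoe.map_comap,
    Subtype.range_coe]
  exact Measure.restrict_eq_self_of_ae_mem (betaMeasure_compl_unitInterval _ _)

lemma map_spacing_zero_eq_betaLaw {l : ℕ} (h : l ≤ Fintype.card ι + 1) :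
    (volume : Measure (ι → I)).map (spacing · 0 l) =
      betaLaw l (Fintype.card ι - l + 1) := by
  have hspacing : ∀ u : ι → I, spacing u 0 l = (orderStatistic u l : I) := fun u => by
    simp [spacing, orderStatistic_zero]
  simp only [hspacing]
  rcases l.eq_zero_or_pos with rfl | hpos
  · simp [orderStatistic_zero, betaLaw]
  rcases h.eq_or_lt with rfl | hlt
  · have hcard : (Fintype.card ι : ℝ) + 1 ≠ 0 := by positivity
    simp [orderStatistic_of_card_lt, betaLaw, hcard]
  · obtain ⟨a, rfl⟩ := Nat.exists_eq_add_of_le' hpos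
    obtain ⟨b, hb⟩ := Nat.exists_eq_add_of_le (Nat.le_of_lt_succ hlt)
    rw [map_orderStatistic_succ_eq_betaMeasure (a := a) (b := b) (by lia), hb]
    have hb' : ((a + 1 + b : ℕ) : ℝ) - (a + 1 : ℕ) + 1 = b + 1 := by push_cast; ring
    rw [hb', betaLaw, if_neg (by positivity), if_neg (by positivity)]
    push_cast
    rfl

lemma map_spacing_eq_betaLaw [Nonempty ι] {a b : ℕ} (hab : a ≤ b) (hb : b ≤ Fintype.card ι + 1) :
    (volume : Measure (ι → I)).map (spacing · a b) =
      betaLaw (b - a) (Fintype.card ι - (b - a) + 1) := by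
  obtain ⟨l, rfl⟩ := Nat.exists_eq_add_of_le hab
  rw [map_spacing_add hb, map_spacing_zero_eq_betaLaw (by lia), Nat.cast_add, add_sub_cancel_left]

end OrderStatisticLaw

section ProbabilityIntegralTransform

variable (ν : Measure ℝ) [IsProbabilityMeasure ν]

/-- The distribution function of `ν` on the extended reals, with values in the unit interval. Being
monotone and preserving `⊥` and `⊤`, it commutes with order statistics of extended reals. -/
noncomputable def extendedCdf (t : EReal) : I :=
  ⟨ν.real {s | (s : EReal) ≤ t}, measureReal_nonneg, measureReal_le_one⟩

lemma monotone_extendedCdf : Monotone (extendedCdf ν) :=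
  fun _ _ h => measureReal_mono fun _ hs => le_trans hs h

lemma extendedCdf_bot : extendedCdf ν ⊥ = ⊥ := by
  apply Subtype.ext
  simp [extendedCdf]

lemma extendedCdf_top : extendedCdf ν ⊤ = ⊤ := by
  apply Subtype.ext
  simp [extendedCdf, Set.ofPred_true]

lemma coe_extendedCdf_coe (t : ℝ) : (extendedCdf ν t : ℝ) = cdf ν t := by
  simp [extendedCdf, cdf_eq_real, Set.Iic_def]

lemma measurable_extendedCdf : Measurable (extendedCdf ν) :=
  (monotone_extendedCdf ν).measurable

lemma extendedCdf_sub_extendedCdf {a b : EReal} (hab : a ≤ b) :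
    (extendedCdf ν b - extendedCdf ν a : ℝ) = ν.real {s | a < s ∧ (s : EReal) ≤ b} := by
  have hsdiff : {s : ℝ | a < s ∧ (s : EReal) ≤ b} =
      {s : ℝ | (s : EReal) ≤ b} \ {s : ℝ | (s : EReal) ≤ a} := by
    ext s
    simp [and_comm]
  have hsub : {s : ℝ | (s : EReal) ≤ a} ⊆ {s : ℝ | (s : EReal) ≤ b} := fun _ hs => le_trans hs hab
  rw [hsdiff, measureReal_sdiff hsub (measurableSet_le measurable_coe_real_ereal measurable_const)]
  rfl

variable [NullSingletonClass ν]

lemma continuous_cdf_of_nullSingletonClass : Continuous (cdf ν) := by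
  refine continuous_iff_continuousAt.2 fun x => ?_
  have hjump := (cdf ν).measure_singleton x
  rw [measure_cdf, measure_singleton, eq_comm, ENNReal.ofReal_eq_zero, sub_nonpos] at hjump
  rw [(monotone_cdf ν).continuousAt_iff_leftLim_eq_rightLim, StieltjesFunction.rightLim_eq]
  exact le_antisymm ((monotone_cdf ν).leftLim_le le_rfl) hjump

lemma surjective_extendedCdf : Function.Surjective (extendedCdf ν) := by
  intro y
  rcases eq_bot_or_bot_lt y with rfl | hpos
  · exact ⟨⊥, extendedCdf_bot ν⟩
  rcases eq_top_or_lt_top y with rfl | hlt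
  · exact ⟨⊤, extendedCdf_top ν⟩
  obtain ⟨s, hs⟩ := ((tendsto_cdf_atBot ν).eventually_lt_const (show (0 : ℝ) < y from hpos)).exists
  obtain ⟨t, ht⟩ := ((tendsto_cdf_atTop ν).eventually_const_lt (show (y : ℝ) < 1 from hlt)).exists
  obtain ⟨r, hr⟩ := mem_range_of_exists_le_of_exists_ge (continuous_cdf_of_nullSingletonClass ν)
    ⟨s, hs.le⟩ ⟨t, ht.le⟩
  exact ⟨r, Subtype.ext ((coe_extendedCdf_coe ν r).trans hr)⟩

lemma map_extendedCdf_coe_eq_volume : ν.map (fun s : ℝ => extendedCdf ν s) = volume := by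
  have hmeas : Measurable fun s : ℝ => extendedCdf ν s :=
    (measurable_extendedCdf ν).comp measurable_coe_real_ereal
  refine Measure.ext_of_Iic _ _ fun y => ?_
  let level : I := ⟨ν.real {s : ℝ | extendedCdf ν s ≤ y}, measureReal_nonneg, measureReal_le_one⟩
  have hlevel : level = y := by
    apply le_antisymm
    · refine le_of_forall_gt_imp_ge_of_dense fun z hyz => ?_
      obtain ⟨t, rfl⟩ := surjective_extendedCdf ν z
      exact measureReal_mono fun s hs =>
        ((monotone_extendedCdf ν).reflect_lt (lt_of_le_of_lt hs hyz)).le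
    · obtain ⟨t, rfl⟩ := surjective_extendedCdf ν y
      exact measureReal_mono fun s hs => monotone_extendedCdf ν hs
  rw [Measure.map_apply hmeas measurableSet_Iic, unitInterval.volume_Iic]
  exact (ofReal_measureReal (measure_ne_top ν _)).symm.trans <|
    congrArg (fun z : I => ENNReal.ofReal z) hlevel

end ProbabilityIntegralTransform

section ConditionalCoverage

variable {Ω ι : Type*} [MeasurableSpace Ω] {μ : Measure Ω}

lemma nullSingletonClass_of_ae_injective {α : Type*} [MeasurableSpace α]
    [MeasurableSingletonClass α] {ν : Measure α} [Nontrivial ι] {V : ι → Ω → α}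
    (hV : ∀ i, HasLaw (V i) ν μ) (hind : iIndepFun V μ)
    (hinj : ∀ᵐ ω ∂μ, Function.Injective (V · ω)) : NullSingletonClass ν := by
  obtain ⟨i, j, hij⟩ := exists_pair_ne ι
  refine ⟨fun t => ?_⟩
  have hmass (k : ι) : μ (V k ⁻¹' {t}) = ν {t} := by
    rw [← (hV k).map_eq,
      Measure.map_apply_of_aemeasurable (hV k).aemeasurable (measurableSet_singleton t)]
  have hzero : μ (V i ⁻¹' {t} ∩ V j ⁻¹' {t}) = 0 := by
    rw [measure_eq_zero_iff_ae_notMem]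
    filter_upwards [hinj] with ω hω h
    exact hij (hω (h.1.trans h.2.symm))
  rwa [(hind.indepFun hij).measure_inter_preimage_eq_mul _ _ (measurableSet_singleton t)
    (measurableSet_singleton t), hmass, hmass, mul_self_eq_zero] at hzero

lemma hasLaw_extendedCdf_pi [Fintype ι] {ν : Measure ℝ} [IsProbabilityMeasure ν]
    [NullSingletonClass ν] {V : ι → Ω → ℝ} (hV : ∀ i, HasLaw (V i) ν μ) (hind : iIndepFun V μ) :
    HasLaw (fun ω i => extendedCdf ν (V i ω)) volume μ := by
  have hmeas : Measurable fun s : ℝ => extendedCdf ν s :=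
    (measurable_extendedCdf ν).comp measurable_coe_real_ereal
  have hunif : HasLaw (fun s : ℝ => extendedCdf ν s) volume ν :=
    ⟨hmeas.aemeasurable, map_extendedCdf_coe_eq_volume ν⟩
  rw [volume_pi]
  exact (hind.comp _ fun _ => hmeas).hasLaw_pi fun i => hunif.comp (hV i)

variable {𝒟 : Type*} [MeasurableSpace 𝒟] {D : Ω → 𝒟} [IsProbabilityMeasure μ]

lemma condExp_indicator_ae_eq_of_indepFun {𝒯 : Type*} [MeasurableSpace 𝒯] [StandardBorelSpace 𝒯]
    [Nonempty 𝒯] {T : Ω → 𝒯} (hD : Measurable D) (hT : AEMeasurable T μ) (hind : IndepFun D T μ)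
    {A : Set (𝒟 × 𝒯)} (hA : MeasurableSet A) :
    μ⟦{ω | (D ω, T ω) ∈ A} | MeasurableSpace.comap D inferInstance⟧ =ᵐ[μ]
      fun ω => (μ.map T).real (Prod.mk (D ω) ⁻¹' A) := by
  have hcond : condDistrib T D μ =ᵐ[μ.map D] Kernel.const 𝒟 (μ.map T) := by
    refine condDistrib_ae_eq_of_measure_eq_compProd D hT ?_
    rw [Measure.compProd_const]
    exact (indepFun_iff_map_prod_eq_prod_map_map hD.aemeasurable hT).1 hind
  have hint : Integrable (A.indicator fun _ => (1 : ℝ)) (μ.map fun ω => (D ω, T ω)) :=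
    (integrable_const 1).indicator hA
  refine (condExp_prod_ae_eq_integral_condDistrib' hD hT hint).trans ?_
  filter_upwards [ae_of_ae_map hD.aemeasurable hcond] with ω hω
  rw [hω, Kernel.const_apply, ← integral_indicator_one (measurable_prodMk_left hA)]
  rfl

variable [Fintype ι] {v : 𝒟 → ι → ℝ} {T : Ω → ℝ} {ν : Measure ℝ} [IsProbabilityMeasure ν]
  {a b : ℕ}

lemma condExp_Ioc_orderStatistic_ae_eq_spacing (hD : Measurable D) (hv : Measurable v)
    (hT : HasLaw T ν μ) (hind : IndepFun D T μ) (hab : a ≤ b) :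
    μ⟦{ω | orderStatistic (fun i => (v (D ω) i : EReal)) a < T ω ∧
        (T ω : EReal) ≤ orderStatistic (fun i => (v (D ω) i : EReal)) b} |
      MeasurableSpace.comap D inferInstance⟧ =ᵐ[μ]
        fun ω => spacing (fun i => extendedCdf ν (v (D ω) i)) a b := by
  let Q (k : ℕ) (d : 𝒟) : EReal := orderStatistic (fun i => (v d i : EReal)) k
  have hQ (k : ℕ) : Measurable (Q k) := (measurable_orderStatistic k).comp <|
    measurable_pi_lambda _ fun i => ((measurable_pi_apply i).comp hv).coe_real_ereal
  let A : Set (𝒟 × ℝ) := {p | Q a p.1 < p.2 ∧ (p.2 : EReal) ≤ Q b p.1}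
  have hA : MeasurableSet A :=
    (measurableSet_lt ((hQ a).comp measurable_fst) measurable_snd.coe_real_ereal).inter
      (measurableSet_le measurable_snd.coe_real_ereal ((hQ b).comp measurable_fst))
  have hcdf (k : ℕ) (d : 𝒟) :
      extendedCdf ν (Q k d) = orderStatistic (fun i => extendedCdf ν (v d i)) k :=
    map_orderStatistic (monotone_extendedCdf ν) (extendedCdf_bot ν) (extendedCdf_top ν) _ k
  filter_upwards [condExp_indicator_ae_eq_of_indepFun hD hT.aemeasurable hind hA] with ω hω
  refine hω.trans ?_
  rw [hT.map_eq, spacing, ← hcdf, ← hcdf, extendedCdf_sub_extendedCdf ν (orderStatistic_mono _ hab)]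
  rfl

lemma hasLaw_condExp_Ioc_orderStatistic [Nonempty ι] [NullSingletonClass ν]
    (hD : Measurable D) (hv : Measurable v) (hT : HasLaw T ν μ)
    (hind : IndepFun D T μ) (hvν : ∀ i, HasLaw (fun ω => v (D ω) i) ν μ)
    (hvind : iIndepFun (fun i ω => v (D ω) i) μ) (hab : a ≤ b) (hb : b ≤ Fintype.card ι + 1) :
    HasLaw (μ⟦{ω | orderStatistic (fun i => (v (D ω) i : EReal)) a < T ω ∧
        (T ω : EReal) ≤ orderStatistic (fun i => (v (D ω) i : EReal)) b} |
      MeasurableSpace.comap D inferInstance⟧)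
      (betaLaw ((b : ℝ) - a) (Fintype.card ι - ((b : ℝ) - a) + 1)) μ := by
  have hspacing : HasLaw (fun u : ι → I => spacing u a b)
      (betaLaw ((b : ℝ) - a) (Fintype.card ι - ((b : ℝ) - a) + 1)) volume :=
    ⟨(measurable_spacing a b).aemeasurable, map_spacing_eq_betaLaw hab hb⟩
  exact (hspacing.comp (hasLaw_extendedCdf_pi hvν hvind)).congr
    (condExp_Ioc_orderStatistic_ae_eq_spacing hD hv hT hind hab)

end ConditionalCoverage

theorem proposition3
    {Ω 𝒳 𝒴 : Type*} [MeasurableSpace Ω] [MeasurableSpace 𝒳] [MeasurableSpace 𝒴]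
    (μ : Measure Ω) [IsProbabilityMeasure μ]
    -- the data distribution, and a (measurable) conformal score
    (P : Measure (𝒳 × 𝒴)) [IsProbabilityMeasure P]
    (s : 𝒳 → 𝒴 → ℝ) (hs : Measurable (fun z : 𝒳 × 𝒴 => s z.1 z.2))
    -- the calibration set: independent samples from `P`
    (m : ℕ) (hm : 0 < m)
    (Dcal : Fin m → Ω → 𝒳 × 𝒴) (hDcal_meas : ∀ i, Measurable (Dcal i))
    (hDcal_law : ∀ i, μ.map (Dcal i) = P) (hDcal_indep : iIndepFun Dcal μ)
    -- the new sample, drawn from `P` independently of the calibration set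
    (X : Ω → 𝒳) (Y : Ω → 𝒴) (hX : Measurable X) (hY : Measurable Y)
    (hXY_law : μ.map (fun ω => (X ω, Y ω)) = P)
    (hXY_indep : IndepFun (fun ω => (X ω, Y ω)) (fun ω i => Dcal i ω) μ)
    -- the calibration scores are almost surely distinct
    (hdistinct : ∀ᵐ ω ∂μ, Function.Injective (fun i => s (Dcal i ω).1 (Dcal i ω).2))
    -- a single score is always distinct: for `m = 1` ask that no score value has positive mass
    (hone : m = 1 → ∀ t : ℝ, P {z | s z.1 z.2 = t} = 0)
    (α₁ α₂ : ℝ) (hα₁ : 0 ≤ α₁) (hα : α₁ < α₂) (hα₂ : α₂ ≤ 1)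
    (l : ℤ) (hl : l = ⌈((m : ℝ) + 1) * (1 - α₁)⌉ - ⌈((m : ℝ) + 1) * (1 - α₂)⌉) :
    HasLaw
      (μ⟦{ω | Y ω ∈ twoThresholdSet s (fun i => s (Dcal i ω).1 (Dcal i ω).2) α₁ α₂ (X ω)} |
        MeasurableSpace.comap (fun ω i => Dcal i ω) inferInstance⟧)
      (betaLaw (l : ℝ) ((m : ℝ) - (l : ℝ) + 1)) μ := by
  let score (z : 𝒳 × 𝒴) : ℝ := s z.1 z.2
  let D (ω : Ω) (i : Fin m) : 𝒳 × 𝒴 := Dcal i ω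
  have : Nonempty (Fin m) := ⟨⟨0, hm⟩⟩
  have : IsProbabilityMeasure (P.map score) := Measure.isProbabilityMeasure_map hs.aemeasurable
  have hscore : HasLaw score (P.map score) P := ⟨hs.aemeasurable, rfl⟩
  have hcal (i : Fin m) : HasLaw (fun ω => score (D ω i)) (P.map score) μ :=
    hscore.comp ⟨(hDcal_meas i).aemeasurable, hDcal_law i⟩
  have hcal_indep : iIndepFun (fun i ω => score (D ω i)) μ := hDcal_indep.comp _ fun _ => hs
  have : NullSingletonClass (P.map score) := by
    rcases eq_or_ne m 1 with h1 | h1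
    · exact ⟨fun t => (Measure.map_apply hs (measurableSet_singleton t)).trans (hone h1 t)⟩
    · have : Nontrivial (Fin m) := Fin.nontrivial_iff_two_le.2 (by lia)
      exact nullSingletonClass_of_ae_injective hcal hcal_indep hdistinct
  have hlaw := hasLaw_condExp_Ioc_orderStatistic (D := D) (v := fun d i => score (d i))
    (measurable_pi_lambda _ hDcal_meas)
    (measurable_pi_lambda _ fun i => hs.comp (measurable_pi_apply i))
    (hscore.comp ⟨(hX.prodMk hY).aemeasurable, hXY_law⟩)
    (hXY_indep.comp hs measurable_id).symm hcal hcal_indep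
    (Nat.ceil_mono (by gcongr) : ⌈((m : ℝ) + 1) * (1 - α₂)⌉₊ ≤ ⌈((m : ℝ) + 1) * (1 - α₁)⌉₊)
    (Nat.ceil_le.2 (by rw [Fintype.card_fin]; push_cast; nlinarith))
  rw [natCast_ceil_eq_intCast_ceil (mul_nonneg (by positivity) (by linarith)),
    natCast_ceil_eq_intCast_ceil (mul_nonneg (by positivity) (by linarith)), ← Int.cast_sub,
    ← hl, Fintype.card_fin] at hlaw
  simp only [twoThresholdSet, conformalThreshold_eq_orderStatistic hm]
  exact hlaw
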